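/- Let $\mathcal A$ be a finite or countable alphabet, $\Omega=\mathcal A^{\mathbb N}$ (with $\mathbb N=\{0,1,2,\dots\}$) with the $\sigma$-algebra generated by cylinder sets, $T:\Omega\to\Omega$ the left shift, and $P$ a $T$-invariant probability measure on $\Omega$. For $0\le m\le n$ let $\mathcal F_{m,n}$ be the $\sigma$-algebra generated by the coordinates $\omega_i$, $m\le i\le n$, and for $k\in\mathbb Z$ let $\mathcal F_{k,\infty}$ be the one generated by the coordinates $\omega_i$, $i\ge \max(k,0)$. For sub-$\sigma$-algebras $\mathcal G,\mathcal H$ put $$\phi(\mathcal G,\mathcal H)=\sup\Big\{\Big|\frac{P(\Gamma\cap\Delta)}{P(\Gamma)}-P(\Delta)\Big| : \Gamma\in\mathcal G,\ \Delta\in\mathcal H,\ P(\Gamma)\ne0\Big\},\qquad \phi(j)=\sup_{m\ge0}\phi(\mathcal F_{0,m},\mathcal F_{m+j,\infty})\quad(j\in\mathbb Z).$$ Assume that $P$ is $\phi$-mixing, i.e. $\phi(j)\to0$ as $j\to\infty$. Let $n,m\ge1$ be integers, let $U\in\mathcal F_{0,n-1}$ and $V\in\mathcal F_{0,m-1}$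 (that is, $U$ is a union of $n$-cylinders and $V$ a union of $m$-cylinders) be nonempty, and suppose $U\cap V=\emptyset$. Write $n\vee m=\max\{n,m\}$, $n\wedge m=\min\{n,m\}$, and define $$\pi(U)=\min\{1\le k\le n: U\cap T^{-k}U\ne\emptyset\},\qquad \pi(V)=\min\{1\le k\le m: V\cap T^{-k}V\ne\emptyset\},$$ $$\pi(U,V)=\min\{0\le k\le n\wedge m: U\cap T^{-k}V\ne\emptyset\text{ or }V\cap T^{-k}U\ne\emptyset\},\qquad \kappa_{U,V}=\min\{\pi(U,V),\pi(U),\pi(V)\},$$ $$\tau_V(\omega)=\min\{k\ge1:T^k\omega\in V\}\in\{1,2,\dots\}\cup\{\infty\},\qquad \Sigma_{U,V}=\sum_{0\le k<\tau_V}\mathbb 1_U\circ T^k .$$ Let $\mathcal L(\Sigma_{U,V})$ be the law of $\Sigma_{U,V}$ under $P$, let $d_{TV}(\mu,\nu)=\sup_G|\mu(G)-\nu(G)|$ (supremum over measurable sets $G$), and for $\rho\in(0,1]$ let $\mathrm{Geo}(\rho)$ be the law with $\mathrm{Geo}(\rho)\{k\}=\rho(1-\rho)^k$, $k=0,1,2,\dots$.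 (If $P(V)=0$, read the geometric law below as $\delta_0$; the inequality is then trivial, since its right-hand side is at least $2$.) Then for all integers $M,R\ge1$ and every integer $r$ with $0\le r<n\wedge m$, writing $U_r=T^rU$ and $V_r=T^rV$, $$\begin{aligned} d_{TV}\Big(\mathcal L(\Sigma_{U,V}),\ \mathrm{Geo}\Big(\frac{P(V)}{P(V)+P(U)}\Big)\Big)\le 2\Big(&(1-P(V))^{M+1}+P(U)+6MR\,(P(U)+P(V))^2+6M\,\phi(R-n\vee m)\\ &+8MR\,(P(U)+P(V))\big(P(U_r)+P(V_r)+\phi(\kappa_{U,V}+r-n\vee m)\big)\Big).\end{aligned}$$ -/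

import Mathlib

open MeasureTheory

noncomputable section

namespace PhiMixingShift

variable {A : Type*}

/-- The left shift `T` on the one-sided sequence space `A^ℕ`. -/
def shift (ω : ℕ → A) : ℕ → A := fun k => ω (k + 1)

/-- The σ-algebra on `A^ℕ` generated by the coordinates `ω i`, `i ∈ I`; for a countable discrete
alphabet it is generated by the cylinder sets that fix coordinates in `I`. -/
@[reducible] def coordSigma (A : Type*) [MeasurableSpace A] (I : Set ℕ) : MeasurableSpace (ℕ → A) :=
  ⨆ i ∈ I, MeasurableSpace.comap (fun ω : ℕ → A => ω i) inferInstance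

/-- `ℱ_{m,n}`: the σ-algebra of the coordinates `m ≤ i ≤ n`. In particular `ℱ_{0,n-1}` consists of
the empty set and the unions of `n`-cylinders. -/
@[reducible] def blockSigma (A : Type*) [MeasurableSpace A] (m n : ℕ) : MeasurableSpace (ℕ → A) :=
  coordSigma A (Set.Icc m n)

/-- `ℱ_{k,∞}`: the σ-algebra of all the coordinates with index `i ≥ k`. An integer `k` is allowed;
for `k ≤ 0` this is the σ-algebra of all the coordinates. -/
@[reducible] def tailSigma (A : Type*) [MeasurableSpace A] (k : ℤ) : MeasurableSpace (ℕ → A) :=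
  coordSigma A {i : ℕ | k ≤ (i : ℤ)}

/-- The dependence coefficient
`φ(𝒢, ℋ) = sup {|P(Γ ∩ Δ) / P(Γ) - P(Δ)| : Γ ∈ 𝒢, Δ ∈ ℋ, P(Γ) ≠ 0}`. -/
def phiDep {Ω : Type*} [MeasurableSpace Ω] (P : Measure Ω) (G H : MeasurableSpace Ω) : ℝ :=
  sSup {x : ℝ | ∃ Γ Δ : Set Ω, MeasurableSet[G] Γ ∧ MeasurableSet[H] Δ ∧ P.real Γ ≠ 0 ∧
    x = |P.real (Γ ∩ Δ) / P.real Γ - P.real Δ|}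

/-- `φ(j) = sup_{m ≥ 0} φ(ℱ_{0,m}, ℱ_{m+j,∞})`, for an arbitrary integer `j`. -/
def phi [MeasurableSpace A] (P : Measure (ℕ → A)) (j : ℤ) : ℝ :=
  ⨆ m : ℕ, phiDep P (blockSigma A 0 m) (tailSigma A ((m : ℤ) + j))

/-- `P` is φ-mixing: `φ(n) → 0` as `n → ∞`. -/
def IsPhiMixing [MeasurableSpace A] (P : Measure (ℕ → A)) : Prop :=
  Filter.Tendsto (fun n : ℕ => phi P (n : ℤ)) Filter.atTop (nhds 0)

/-- `π(U) = min {1 ≤ k ≤ n : U ∩ T⁻ᵏ U ≠ ∅}` for a nonempty union `U` of `n`-cylinders. -/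
def selfReturn (n : ℕ) (U : Set (ℕ → A)) : ℕ :=
  sInf {k : ℕ | 1 ≤ k ∧ k ≤ n ∧ (U ∩ shift^[k] ⁻¹' U).Nonempty}

/-- `π(U, V) = min {0 ≤ k ≤ n ∧ m : U ∩ T⁻ᵏ V ≠ ∅ or V ∩ T⁻ᵏ U ≠ ∅}`. -/
def crossReturn (n m : ℕ) (U V : Set (ℕ → A)) : ℕ :=
  sInf {k : ℕ | k ≤ min n m ∧
    ((U ∩ shift^[k] ⁻¹' V).Nonempty ∨ (V ∩ shift^[k] ⁻¹' U).Nonempty)}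

/-- `κ_{U,V} = min {π(U,V), π(U), π(V)}`. -/
def kappa (n m : ℕ) (U V : Set (ℕ → A)) : ℕ :=
  min (crossReturn n m U V) (min (selfReturn n U) (selfReturn m V))

/-- `τ_V(ω) = min {k ≥ 1 : Tᵏ ω ∈ V}`, equal to `∞` if there is no such `k`. -/
def hitTime (V : Set (ℕ → A)) (ω : ℕ → A) : ℕ∞ :=
  ⨅ (k : ℕ) (_ : 1 ≤ k ∧ shift^[k] ω ∈ V), (k : ℕ∞)

/-- `Σ_{U,V} = ∑_{0 ≤ k < τ_V} 1_U ∘ Tᵏ`, that is, the number of times `0 ≤ k < τ_V(ω)` with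
`Tᵏ ω ∈ U`. -/
def visits (U V : Set (ℕ → A)) (ω : ℕ → A) : ℕ∞ :=
  {k : ℕ | (k : ℕ∞) < hitTime V ω ∧ shift^[k] ω ∈ U}.encard

/-- The total variation distance `sup_G |μ(G) - ν(G)|` over the measurable sets `G`. -/
def tvDist {α : Type*} [MeasurableSpace α] (μ ν : Measure α) : ℝ :=
  sSup {x : ℝ | ∃ G : Set α, MeasurableSet G ∧ x = |μ.real G - ν.real G|}

/-- The parameter `P(V) / (P(V) + P(U))`, a number in `[0, 1]`. -/
def geoParam {Ω : Type*} [MeasurableSpace Ω] (P : Measure Ω) (U V : Set Ω) : unitInterval :=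
  ⟨P.real V / (P.real V + P.real U),
    div_nonneg measureReal_nonneg (add_nonneg measureReal_nonneg measureReal_nonneg),
    div_le_one_of_le₀ (le_add_of_nonneg_right measureReal_nonneg)
      (add_nonneg measureReal_nonneg measureReal_nonneg)⟩

/-- `Geo(ρ)`, giving mass `ρ (1 - ρ)ᵏ` to `k = 0, 1, 2, …`, as a law on `{0, 1, 2, …} ∪ {∞}`
(where the number of visits takes its values). -/
def geoLaw (ρ : unitInterval) : Measure ℕ∞ :=
  (ProbabilityTheory.geometricMeasure ρ).map (fun k : ℕ => (k : ℕ∞))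

end PhiMixingShift

end

noncomputable section

namespace PhiMixingShift

variable {A : Type*}

/-! Write a = P(U), b = P(V), ρ = b/(a+b). Follow the orbit from time 1, counting visits to U and
stopping at the first visit to V. If each time gave a visit to U or V with probabilities a and b
independently of the past, then h(c) = P(c + Geo(ρ) ∈ S), the chance that a count now equal to c
ends in S, would be harmonic: b(1_S(c) - h(c)) + a(h(c+1) - h(c)) = 0 (`geoShift_geoParam`). The
final count would then lie in S with probability h(0) = Geo(ρ)(S). With a horizon N, `potential`
adds (1-b)^k when k steps remain: at k = 0 this pays for the orbits that have not met V, and at the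
start it costs (1-b)^N.

For the actual process, `killed_potential_succ` isolates the error of one step: two terms in which
the indicator of a visit at time j+1 is compared with its mean, given the past. In
`abs_integral_killed_mul_sub_le` the last R times are removed from the past; φ-mixing handles what
remains, and the removal matters only if U ∪ V is visited in that window. The cost is a product of
probabilities plus the probability of a quick return to U ∪ V. Returns before κ are impossible; for
later ones `measureReal_inter_preimage_le` replaces the returning set by its image under T^r, which
gains r in the mixing gap.

Summing over N = M+1 steps, with P(U) for the uncounted time 0, bounds the law above by the
geometric one on every set; complements give the other side. -/

lemma shift_iterate_apply (d : ℕ) (ω : ℕ → A) (i : ℕ) : shift^[d] ω i = ω (i + d) := by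
  induction d generalizing ω with
  | zero => rfl
  | succ d ih => rw [Function.iterate_succ_apply, ih, shift, add_assoc]

/-- This makes T^r U measurable, which images need not be in general. The first r letters of a
preimage are kept and the new sequence is appended; the result still lies in U. -/
lemma dependsOn_image_shift {n r : ℕ} {U : Set (ℕ → A)}
    (hU : DependsOn (fun ω => ω ∈ U) (Set.Icc 0 n)) :
    DependsOn (fun ω => ω ∈ shift^[r] '' U) (Set.Icc 0 n) := by
  have key : ∀ x y : ℕ → A, (∀ i ∈ Set.Icc 0 n, x i = y i) →
      x ∈ shift^[r] '' U → y ∈ shift^[r] '' U := by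
    rintro _ y hxy ⟨u, hu, rfl⟩
    refine ⟨fun i => if i < r then u i else y (i - r), ?_, ?_⟩
    · refine (hU fun i hi => ?_).mp hu
      by_cases h : i < r
      · simp [h]
      · simp only [h, if_false]
        rw [← hxy (i - r) (by simp at hi ⊢; omega), shift_iterate_apply]
        congr 1; omega
    · funext i
      simp [shift_iterate_apply]
  exact fun x y hxy => propext ⟨key x y hxy, key y x fun i hi => (hxy i hi).symm⟩

lemma lt_hitTime_iff {V : Set (ℕ → A)} {ω : ℕ → A} {k : ℕ} :
    (k : ℕ∞) < hitTime V ω ↔ ∀ j ∈ Finset.Icc 1 k, shift^[j] ω ∉ V := by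
  rw [← not_le, hitTime]
  constructor
  · intro h j hj hV
    rw [Finset.mem_Icc] at hj
    exact h (iInf₂_le_of_le j ⟨hj.1, hV⟩ (by exact_mod_cast hj.2))
  · intro h hle
    have hlt : ((k : ℕ∞)) < k + 1 := by exact_mod_cast Nat.lt_succ_self k
    refine absurd (hlt.trans_le (le_iInf₂ fun j hj => ?_)) (not_lt.2 hle)
    by_contra hj'
    have : j < k + 1 := by
      rw [not_le] at hj'
      exact_mod_cast hj'
    exact h j (Finset.mem_Icc.2 ⟨hj.1, by omega⟩) hj.2

/-! ### Measurability and finite dependence -/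

section Measurability

variable [MeasurableSpace A]

lemma measurable_coord {I : Set ℕ} {i : ℕ} (hi : i ∈ I) :
    Measurable[coordSigma A I] (fun ω : ℕ → A => ω i) :=
  measurable_iff_comap_le.2 <|
    le_iSup₂_of_le (f := fun i (_ : i ∈ I) =>
      MeasurableSpace.comap (fun ω : ℕ → A => ω i) inferInstance) i hi le_rfl

lemma coordSigma_le (I : Set ℕ) : coordSigma A I ≤ MeasurableSpace.pi :=
  iSup₂_le fun i _ => measurable_iff_comap_le.1 (measurable_pi_apply i)

lemma dependsOn_of_measurableSet {I : Set ℕ} {S : Set (ℕ → A)}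
    (hS : MeasurableSet[coordSigma A I] S) : DependsOn (fun ω => ω ∈ S) I := by
  have hle : coordSigma A I ≤ MeasurableSpace.comap I.domRestrict MeasurableSpace.pi := by
    refine iSup₂_le fun i hi => ?_
    have : (fun ω : ℕ → A => ω i) = (fun x : I → A => x ⟨i, hi⟩) ∘ I.domRestrict := rfl
    rw [this, ← MeasurableSpace.comap_comp]
    exact MeasurableSpace.comap_mono (measurable_iff_comap_le.1 (measurable_pi_apply _))
  obtain ⟨S', -, rfl⟩ := hle S hS
  intro x y hxy
  have : I.domRestrict x = I.domRestrict y := funext fun i => hxy i i.2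
  simp [this]

/-- For finite I there are only countably many words on I, so every set of words is measurable. -/
lemma measurableSet_of_dependsOn [Countable A] [MeasurableSingletonClass A] {I : Set ℕ}
    (hI : I.Finite) {S : Set (ℕ → A)} (hS : DependsOn (fun ω => ω ∈ S) I) :
    MeasurableSet[coordSigma A I] S := by
  have := hI.to_subtype
  have hmeas : Measurable[coordSigma A I] (I.domRestrict : (ℕ → A) → (I → A)) :=
    @measurable_pi_lambda _ _ _ (coordSigma A I) _ _ fun i => measurable_coord i.2
  have hS' : S = I.domRestrict ⁻¹' (I.domRestrict '' S) := by
    refine Set.Subset.antisymm (Set.subset_preimage_image _ _) ?_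
    rintro ω ⟨ω', hω', h⟩
    exact (hS fun i hi => congrFun h ⟨i, hi⟩).mp hω'
  rw [hS']
  exact hmeas (Set.to_countable _).measurableSet

lemma measurable_shift_iterate (d : ℕ) : Measurable (shift^[d] : (ℕ → A) → (ℕ → A)) :=
  measurable_pi_iff.2 fun i => by
    simpa only [shift_iterate_apply] using measurable_pi_apply (i + d)

lemma measurableSet_tailSigma_preimage {k : ℤ} {d : ℕ} (hk : k ≤ d) {B : Set (ℕ → A)}
    (hB : MeasurableSet B) : MeasurableSet[tailSigma A k] (shift^[d] ⁻¹' B) := by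
  have : Measurable[tailSigma A k] (shift^[d] : (ℕ → A) → (ℕ → A)) := by
    refine @measurable_pi_lambda _ _ _ (tailSigma A k) _ _ fun i => ?_
    simp only [shift_iterate_apply]
    exact measurable_coord (by simp only [Set.mem_ofPred_eq]; push_cast; omega)
  exact this hB

lemma measurable_visits {U V : Set (ℕ → A)} (hU : MeasurableSet U) (hV : MeasurableSet V) :
    Measurable (visits U V) := by
  refine measurable_encard.comp (measurable_set_iff.2 fun k => ?_)
  simp only [Set.mem_ofPred_eq, lt_hitTime_iff]
  refine Measurable.and (Measurable.forall fun j => Measurable.imp measurable_const ?_) ?_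
  · exact (measurableSet_setOfPred.1 (measurable_shift_iterate j hV)).not
  · exact measurableSet_setOfPred.1 (measurable_shift_iterate k hU)

end Measurability

/-! ### Mixing coefficients -/

section Mixing

lemma abs_condProb_sub_le_one {Ω : Type*} [MeasurableSpace Ω] (P : Measure Ω)
    [IsProbabilityMeasure P] (Γ Δ : Set Ω) :
    |P.real (Γ ∩ Δ) / P.real Γ - P.real Δ| ≤ 1 := by
  have h1 : P.real (Γ ∩ Δ) / P.real Γ ≤ 1 :=
    div_le_one_of_le₀ (measureReal_mono Set.inter_subset_left) measureReal_nonneg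
  have h2 : 0 ≤ P.real (Γ ∩ Δ) / P.real Γ := div_nonneg measureReal_nonneg measureReal_nonneg
  have h3 : P.real Δ ≤ 1 := measureReal_le_one
  have h4 : 0 ≤ P.real Δ := measureReal_nonneg
  rw [abs_le]; constructor <;> linarith

lemma phiDep_le_one {Ω : Type*} {mΩ : MeasurableSpace Ω} (P : Measure Ω)
    [IsProbabilityMeasure P] (G H : MeasurableSpace Ω) : @phiDep Ω mΩ P G H ≤ 1 :=
  Real.sSup_le (by rintro _ ⟨Γ, Δ, -, -, -, rfl⟩; exact @abs_condProb_sub_le_one _ mΩ P _ Γ Δ) zero_le_one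

lemma phiDep_nonneg {Ω : Type*} {mΩ : MeasurableSpace Ω} (P : Measure Ω)
    (G H : MeasurableSpace Ω) : 0 ≤ @phiDep Ω mΩ P G H :=
  Real.sSup_nonneg (by rintro _ ⟨Γ, Δ, -, -, -, rfl⟩; exact abs_nonneg _)

lemma phi_nonneg [MeasurableSpace A] (P : Measure (ℕ → A)) (j : ℤ) : 0 ≤ phi P j := Real.iSup_nonneg fun _ => phiDep_nonneg _ _ _

/-- The defining property of the mixing coefficient, in product form. -/
lemma abs_measureReal_inter_sub_le [MeasurableSpace A] (P : Measure (ℕ → A))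
    [IsProbabilityMeasure P] {a d : ℕ} {j : ℤ} (hj : (a : ℤ) + j ≤ d) {Γ B : Set (ℕ → A)}
    (hΓ : MeasurableSet[blockSigma A 0 a] Γ) (hB : MeasurableSet B) :
    |P.real (Γ ∩ shift^[d] ⁻¹' B) - P.real Γ * P.real (shift^[d] ⁻¹' B)|
      ≤ P.real Γ * phi P j := by
  set Δ := shift^[d] ⁻¹' B
  rcases eq_or_ne (P.real Γ) 0 with h0 | h0
  · have : P.real (Γ ∩ Δ) = 0 :=
      le_antisymm (h0 ▸ measureReal_mono Set.inter_subset_left) measureReal_nonneg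
    simp [h0, this]
  -- A real supremum is an upper bound only for a bounded set; the bound 1 serves here and in `h2`.
  have h1 : |P.real (Γ ∩ Δ) / P.real Γ - P.real Δ|
      ≤ phiDep P (blockSigma A 0 a) (tailSigma A ((a : ℤ) + j)) :=
    le_csSup ⟨1, by rintro _ ⟨Γ, Δ, -, -, -, rfl⟩; exact abs_condProb_sub_le_one P Γ Δ⟩
      ⟨Γ, Δ, hΓ, measurableSet_tailSigma_preimage hj hB, h0, rfl⟩
  have h2 : phiDep P (blockSigma A 0 a) (tailSigma A ((a : ℤ) + j)) ≤ phi P j :=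
    le_ciSup (f := fun m : ℕ => phiDep P (blockSigma A 0 m) (tailSigma A ((m : ℤ) + j)))
      ⟨1, by rintro _ ⟨m, rfl⟩; exact phiDep_le_one P _ _⟩ a
  have h3 : P.real (Γ ∩ Δ) - P.real Γ * P.real Δ
      = P.real Γ * (P.real (Γ ∩ Δ) / P.real Γ - P.real Δ) := by field_simp
  rw [h3, abs_mul, abs_of_nonneg measureReal_nonneg]
  exact mul_le_mul_of_nonneg_left (h1.trans h2) measureReal_nonneg

end Mixing

/-! ### The geometric law -/

section Geometric

open ProbabilityTheory

/-- First step decomposition of a geometric law. -/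
lemma geometricMeasure_real_succ {ρ : unitInterval} (hρ : ρ ≠ 0) (S : Set ℕ) :
    (geometricMeasure ρ).real S = (ρ : ℝ) * S.indicator 1 0
      + (1 - ρ) * (geometricMeasure ρ).real {k | k + 1 ∈ S} := by
  have hsum : ∀ S : Set ℕ, HasSum (fun k => (1 - ρ : ℝ) ^ k * ρ * S.indicator 1 k)
      ((geometricMeasure ρ).real S) := by
    intro S
    have h := hasSum_integral_geometricMeasure hρ (f := S.indicator (1 : ℕ → ℝ))
      ((integrable_const (1 : ℝ)).indicator (MeasurableSet.of_discrete))
    rw [integral_indicator_one MeasurableSet.of_discrete] at h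
    simpa only [smul_eq_mul] using h
  have h1 := (hsum {k | k + 1 ∈ S}).mul_left (1 - ρ : ℝ)
  have h2 := (hasSum_nat_add_iff' 1).2 (hsum S)
  have heq : (fun k => (1 - ρ : ℝ) * ((1 - ρ : ℝ) ^ k * ρ * Set.indicator {k | k + 1 ∈ S} 1 k))
      = fun k => (1 - ρ : ℝ) ^ (k + 1) * ρ * S.indicator 1 (k + 1) := by
    funext k
    have : ({k | k + 1 ∈ S} : Set ℕ).indicator (1 : ℕ → ℝ) k = S.indicator 1 (k + 1) := by
      simp [Set.indicator]
    rw [this]; ring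
  rw [heq] at h1
  have h3 := h1.unique h2
  simp only [Finset.range_one, Finset.sum_singleton, pow_zero, one_mul] at h3
  linarith

end Geometric

/-! ### The visit count killed at the first visit to V -/

/-- The event that there is no visit to `V` at the times `1, …, j`. -/
def noHit (V : Set (ℕ → A)) (j : ℕ) : Set (ℕ → A) :=
  {ω | ∀ k ∈ Finset.Icc 1 j, shift^[k] ω ∉ V}

/-- The number of visits to `U` at the times `1, …, j`. -/
def visitCount (U : Set (ℕ → A)) (j : ℕ) (ω : ℕ → A) : ℕ :=
  ∑ k ∈ Finset.Icc 1 j, U.indicator 1 (shift^[k] ω)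

/-- A function of the number of visits to `U` up to time `j`, killed at the first visit to `V`. -/
def killed (U V : Set (ℕ → A)) (f : ℕ → ℝ) (j : ℕ) : (ℕ → A) → ℝ :=
  (noHit V j).indicator fun ω => f (visitCount U j ω)

lemma visitCount_le (U : Set (ℕ → A)) (j : ℕ) (ω : ℕ → A) : visitCount U j ω ≤ j := by
  refine (Finset.sum_le_card_nsmul _ _ 1 fun k _ => ?_).trans (by simp)
  exact Set.indicator_apply_le' (fun _ => le_rfl) (fun _ => zero_le_one)

lemma visitCount_succ (U : Set (ℕ → A)) (j : ℕ) (ω : ℕ → A) :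
    visitCount U (j + 1) ω = visitCount U j ω + U.indicator 1 (shift^[j + 1] ω) := by
  rw [visitCount, Finset.sum_Icc_succ_top (by omega), visitCount]

lemma mem_noHit_succ {V : Set (ℕ → A)} {j : ℕ} {ω : ℕ → A} :
    ω ∈ noHit V (j + 1) ↔ ω ∈ noHit V j ∧ shift^[j + 1] ω ∉ V := by
  simp only [noHit, Set.mem_ofPred_eq, Finset.mem_Icc]
  constructor
  · exact fun h => ⟨fun k hk => h k (by omega), h _ (by omega)⟩
  · rintro ⟨h1, h2⟩ k hk
    rcases eq_or_ne k (j + 1) with rfl | hne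
    · exact h2
    · exact h1 k (by omega)

lemma abs_killed_le {U V : Set (ℕ → A)} {f : ℕ → ℝ} {C : ℝ} (hf : ∀ c, |f c| ≤ C) (j : ℕ)
    (ω : ℕ → A) : |killed U V f j ω| ≤ C := by
  rw [killed, Set.indicator]
  split_ifs
  · exact hf _
  · simpa using (abs_nonneg _).trans (hf 0)

/-- The evolution of `killed` in one step. -/
lemma killed_succ {U V : Set (ℕ → A)} (hUV : Disjoint U V) (f g : ℕ → ℝ) (j : ℕ) (ω : ℕ → A) :
    killed U V g j ω * (shift^[j + 1] ⁻¹' V).indicator 1 ω + killed U V f (j + 1) ω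
      = killed U V f j ω
        + killed U V (fun c => g c - f c) j ω * (shift^[j + 1] ⁻¹' V).indicator 1 ω
        + killed U V (fun c => f (c + 1) - f c) j ω * (shift^[j + 1] ⁻¹' U).indicator 1 ω := by
  by_cases h : ω ∈ noHit V j
  · by_cases hV : shift^[j + 1] ω ∈ V
    · have hU : shift^[j + 1] ω ∉ U := fun hU => Set.disjoint_left.1 hUV hU hV
      simp [-Function.iterate_succ, killed, Set.indicator, mem_noHit_succ, h, hV, hU]
    · by_cases hU : shift^[j + 1] ω ∈ U <;>
      simp [-Function.iterate_succ, killed, Set.indicator, mem_noHit_succ, visitCount_succ, h, hV, hU]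
  · simp [killed, mem_noHit_succ, h]

/-- `killed` does not change while neither set is visited. -/
lemma killed_eq_of_forall_notMem {U V : Set (ℕ → A)} (f : ℕ → ℝ) {q j : ℕ} (hqj : q ≤ j)
    {ω : ℕ → A} (h : ∀ k ∈ Finset.Ioc q j, shift^[k] ω ∉ U ∪ V) :
    killed U V f j ω = killed U V f q ω := by
  induction j, hqj using Nat.le_induction with
  | base => rfl
  | succ j hqj ih =>
    have hj := h (j + 1) (by simp; omega)
    rw [Set.mem_union, not_or] at hj
    rw [← ih fun k hk => h k (by simp at hk ⊢; omega)]
    by_cases hω : ω ∈ noHit V j <;>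
    simp [-Function.iterate_succ, killed, Set.indicator, mem_noHit_succ, visitCount_succ, hω, hj.1,
      hj.2]

/-- The two counts differ only at time 0, which `h0` excludes. -/
lemma visits_eq_visitCount {U V : Set (ℕ → A)} {ω : ℕ → A} {j : ℕ} (h0 : ω ∉ U)
    (hj : ω ∈ noHit V j) (hV : shift^[j + 1] ω ∈ V) : visits U V ω = visitCount U j ω := by
  classical
  have hset : {k : ℕ | (k : ℕ∞) < hitTime V ω ∧ shift^[k] ω ∈ U}
      = ((Finset.Icc 1 j).filter fun k => shift^[k] ω ∈ U : Finset ℕ) := by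
    ext k
    simp only [Set.mem_ofPred_eq, lt_hitTime_iff, Finset.coe_filter, Finset.mem_Icc]
    constructor
    · rintro ⟨h1, h2⟩
      refine ⟨⟨Nat.one_le_iff_ne_zero.2 ?_, ?_⟩, h2⟩
      · rintro rfl
        exact h0 h2
      · by_contra hk
        exact h1 (j + 1) (by omega) hV
    · rintro ⟨h1, h2⟩
      exact ⟨fun i hi => hj i (by simp; omega), h2⟩
  rw [visits, hset, Set.encard_coe_eq_coe_finsetCard, Finset.card_filter, visitCount]
  simp [Set.indicator]

/-- Outside `U`, the number of visits either is the count at the first visit to `V`, which occurs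
before time `N`, or there is no visit to `V` until time `N`. -/
lemma indicator_visits_le {U V : Set (ℕ → A)} (G : Set ℕ∞) (N : ℕ) (ω : ℕ → A) :
    (visits U V ⁻¹' G).indicator (1 : (ℕ → A) → ℝ) ω ≤ U.indicator 1 ω
      + ∑ j ∈ Finset.range N, killed U V (((↑) ⁻¹' G : Set ℕ).indicator 1) j ω
          * (shift^[j + 1] ⁻¹' V).indicator 1 ω
      + killed U V 1 N ω := by
  have hterm : ∀ j, 0 ≤ killed U V (((↑) ⁻¹' G : Set ℕ).indicator 1) j ω
      * (shift^[j + 1] ⁻¹' V).indicator (1 : (ℕ → A) → ℝ) ω := fun j =>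
    mul_nonneg (Set.indicator_nonneg (fun _ _ => Set.indicator_nonneg (fun _ _ => zero_le_one) _) _)
      (Set.indicator_nonneg (fun _ _ => zero_le_one) _)
  have hsum := Finset.sum_nonneg fun j (_ : j ∈ Finset.range N) => hterm j
  have hN : 0 ≤ killed U V 1 N ω := Set.indicator_nonneg (fun _ _ => zero_le_one) _
  have hU : 0 ≤ U.indicator (1 : (ℕ → A) → ℝ) ω := Set.indicator_nonneg (fun _ _ => zero_le_one) _
  have hle : (visits U V ⁻¹' G).indicator (1 : (ℕ → A) → ℝ) ω ≤ 1 :=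
    Set.indicator_apply_le' (fun _ => le_rfl) (fun _ => zero_le_one)
  by_cases h0 : ω ∈ U
  · have : U.indicator (1 : (ℕ → A) → ℝ) ω = 1 := by simp [h0]
    linarith
  by_cases hω : ω ∈ noHit V N
  · have : killed U V 1 N ω = 1 := by simp [killed, hω]
    linarith
  have hex : ∃ j, ω ∉ noHit V j := ⟨N, hω⟩
  classical
  -- Avoiding V up to time 0 is vacuous, so the first failure has the form t + 1, and t + 1 is the
  -- first visit to V.
  obtain ⟨t, ht⟩ : ∃ t, Nat.find hex = t + 1 := by
    refine Nat.exists_eq_succ_of_ne_zero fun h => ?_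
    exact (Nat.find_eq_zero hex).1 h (by simp [noHit])
  have ht1 : ω ∈ noHit V t := not_not.1 (Nat.find_min hex (m := t) (by omega))
  have ht2 : shift^[t + 1] ω ∈ V := by
    by_contra hV
    exact (ht ▸ Nat.find_spec hex) (mem_noHit_succ.2 ⟨ht1, hV⟩)
  have htN : t < N := by
    have := Nat.find_min' hex hω
    omega
  have hval : killed U V (((↑) ⁻¹' G : Set ℕ).indicator 1) t ω
      * (shift^[t + 1] ⁻¹' V).indicator (1 : (ℕ → A) → ℝ) ω
        = (visits U V ⁻¹' G).indicator (1 : (ℕ → A) → ℝ) ω := by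
    simp [-Function.iterate_succ, killed, ht1, ht2, Set.indicator, visits_eq_visitCount h0 ht1 ht2]
  have := Finset.single_le_sum (fun j _ => hterm j) (Finset.mem_range.2 htN)
  linarith

/-! ### Dependence on finitely many coordinates -/

section Dependence

variable {U V : Set (ℕ → A)} {L : ℕ}

lemma mem_shift_iterate_iff_of_dependsOn (hU : DependsOn (fun ω => ω ∈ U) (Set.Icc 0 L)) {q k : ℕ}
    (hk : k ≤ q) {x y : ℕ → A} (hxy : ∀ i ∈ Set.Icc 0 (q + L), x i = y i) :
    shift^[k] x ∈ U ↔ shift^[k] y ∈ U :=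
  Iff.of_eq <| hU fun i hi => by
    rw [shift_iterate_apply, shift_iterate_apply]
    exact hxy _ (by simp at hi ⊢; omega)

lemma dependsOn_noHit_visitCount (hU : DependsOn (fun ω => ω ∈ U) (Set.Icc 0 L))
    (hV : DependsOn (fun ω => ω ∈ V) (Set.Icc 0 L)) (q c : ℕ) :
    DependsOn (fun ω => ω ∈ noHit V q ∩ visitCount U q ⁻¹' {c}) (Set.Icc 0 (q + L)) := by
  classical
  intro x y hxy
  have h1 : x ∈ noHit V q ↔ y ∈ noHit V q := by
    refine forall₂_congr fun k hk => not_congr (mem_shift_iterate_iff_of_dependsOn hV ?_ hxy)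
    exact (Finset.mem_Icc.1 hk).2
  have h2 : visitCount U q x = visitCount U q y := by
    refine Finset.sum_congr rfl fun k hk => ?_
    have := mem_shift_iterate_iff_of_dependsOn hU (Finset.mem_Icc.1 hk).2 hxy
    simp [Set.indicator, this]
  simp [h1, h2]

/-- Since the count is at most q, the killed function is a finite combination of indicators of
events of the past, the only objects to which φ applies. -/
lemma killed_eq_sum (f : ℕ → ℝ) (q : ℕ) (ω : ℕ → A) :
    killed U V f q ω = ∑ c ∈ Finset.range (q + 1),
      f c * (noHit V q ∩ visitCount U q ⁻¹' {c}).indicator 1 ω := by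
  rw [Finset.sum_eq_single (visitCount U q ω)]
  · by_cases h : ω ∈ noHit V q <;> simp [killed, h]
  · intro c _ hc
    simp [Set.indicator, hc.symm]
  · intro h
    exact absurd (Finset.mem_range.2 (Nat.lt_succ_of_le (visitCount_le U q ω))) h

end Dependence

/-! ### Integrals and decorrelation -/

section Integrals

variable [MeasurableSpace A] {U V : Set (ℕ → A)}

lemma measurableSet_noHit (hV : MeasurableSet V) (j : ℕ) : MeasurableSet (noHit V j) := by
  have : noHit V j = ⋂ k ∈ Finset.Icc 1 j, (shift^[k] ⁻¹' V)ᶜ := by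
    ext; simp [noHit]
  rw [this]
  exact Finset.measurableSet_biInter _ fun k _ => (measurable_shift_iterate k hV).compl

lemma measurable_visitCount (hU : MeasurableSet U) (j : ℕ) : Measurable (visitCount U j) :=
  Finset.measurable_sum _ fun k _ =>
    (measurable_one.indicator hU).comp (measurable_shift_iterate k)

lemma measurable_killed (hU : MeasurableSet U) (hV : MeasurableSet V) (f : ℕ → ℝ) (j : ℕ) :
    Measurable (killed U V f j) :=
  ((Measurable.of_discrete (f := f)).comp (measurable_visitCount hU j)).indicator
    (measurableSet_noHit hV j)

lemma integrable_of_abs_le {Ω : Type*} [MeasurableSpace Ω] {P : Measure Ω} [IsFiniteMeasure P]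
    {X : Ω → ℝ} (hX : Measurable X) {C : ℝ} (h : ∀ ω, |X ω| ≤ C) : Integrable X P :=
  Integrable.of_bound hX.aestronglyMeasurable C (ae_of_all _ h)

lemma integrable_mul_indicator {Ω : Type*} [MeasurableSpace Ω] {P : Measure Ω}
    {X : Ω → ℝ} (hX : Integrable X P) {D : Set Ω} (hD : MeasurableSet D) :
    Integrable (fun ω => X ω * D.indicator 1 ω) P := by
  refine (hX.indicator hD).congr (ae_of_all _ fun ω => ?_)
  by_cases h : ω ∈ D <;> simp [h]

lemma integrable_mul_indicator_sub {Ω : Type*} [MeasurableSpace Ω] {P : Measure Ω}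
    {X : Ω → ℝ} (hX : Integrable X P) {D : Set Ω} (hD : MeasurableSet D) (b : ℝ) :
    Integrable (fun ω => X ω * (D.indicator 1 ω - b)) P := by
  simp only [mul_sub]
  exact (integrable_mul_indicator hX hD).sub (hX.mul_const b)

lemma integral_indicator_mul_indicator_sub {Ω : Type*} [MeasurableSpace Ω] {P : Measure Ω}
    [IsFiniteMeasure P] {E D : Set Ω} (hE : MeasurableSet E) (hD : MeasurableSet D) (b : ℝ) :
    ∫ ω, E.indicator (1 : Ω → ℝ) ω * (D.indicator 1 ω - b) ∂P
      = P.real (E ∩ D) - P.real E * b := by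
  have hi : Integrable (E.indicator (1 : Ω → ℝ)) P := (integrable_const (1 : ℝ)).indicator hE
  simp only [mul_sub]
  rw [integral_sub (integrable_mul_indicator hi hD) (hi.mul_const b), integral_mul_const,
    integral_indicator_one hE, ← integral_indicator_one (hE.inter hD)]
  congr 2
  funext ω
  rw [Set.inter_indicator_one]; rfl

/-- Decorrelation of the past, up to a time `q`, from a set that is visited later. -/
lemma abs_integral_killed_le [Countable A] [MeasurableSingletonClass A] (P : Measure (ℕ → A))
    [IsProbabilityMeasure P] {L : ℕ}
    (hU : DependsOn (fun ω => ω ∈ U) (Set.Icc 0 L)) (hV : DependsOn (fun ω => ω ∈ V) (Set.Icc 0 L))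
    {f : ℕ → ℝ} {C : ℝ} (hf : ∀ c, |f c| ≤ C) {q d : ℕ} {i : ℤ}
    (hq : ((q + L : ℕ) : ℤ) + i ≤ d) {B : Set (ℕ → A)} (hB : MeasurableSet B) :
    |∫ ω, killed U V f q ω * ((shift^[d] ⁻¹' B).indicator 1 ω - P.real (shift^[d] ⁻¹' B)) ∂P|
      ≤ C * phi P i := by
  have hC : 0 ≤ C := (abs_nonneg _).trans (hf 0)
  set Γ : ℕ → Set (ℕ → A) := fun c => noHit V q ∩ visitCount U q ⁻¹' {c}
  have hΓm : ∀ c, MeasurableSet[blockSigma A 0 (q + L)] (Γ c) := fun c =>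
    measurableSet_of_dependsOn (Set.finite_Icc _ _) (dependsOn_noHit_visitCount hU hV q c)
  have hΓm' : ∀ c, MeasurableSet (Γ c) := fun c => coordSigma_le _ _ (hΓm c)
  have hD := measurable_shift_iterate d hB
  set D := shift^[d] ⁻¹' B
  have hint : ∫ ω, killed U V f q ω * (D.indicator 1 ω - P.real D) ∂P
      = ∑ c ∈ Finset.range (q + 1), f c * (P.real (Γ c ∩ D) - P.real (Γ c) * P.real D) := by
    simp only [killed_eq_sum, Finset.sum_mul, mul_assoc]
    rw [integral_finsetSum]
    · refine Finset.sum_congr rfl fun c _ => ?_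
      rw [integral_const_mul, integral_indicator_mul_indicator_sub (hΓm' c) hD]
    · exact fun c _ => (integrable_mul_indicator_sub (P := P)
        ((integrable_const (1 : ℝ)).indicator (hΓm' c)) hD _).const_mul _
  have hdisj : Pairwise (Function.onFun Disjoint Γ) := fun c c' hne =>
    Set.disjoint_left.2 fun ω h h' => hne (h.2.symm.trans h'.2)
  -- The error on each event is at most P(Γ c)·φ, and the events are disjoint, so the total error
  -- does not grow with q.
  have hone : ∑ c ∈ Finset.range (q + 1), P.real (Γ c) ≤ 1 := by
    rw [← measureReal_biUnion_finset (fun c _ c' _ h => hdisj h) fun c _ => hΓm' c]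
    exact measureReal_le_one
  rw [hint]
  calc |∑ c ∈ Finset.range (q + 1), f c * (P.real (Γ c ∩ D) - P.real (Γ c) * P.real D)|
      ≤ ∑ c ∈ Finset.range (q + 1), C * (P.real (Γ c) * phi P i) := by
        refine (Finset.abs_sum_le_sum_abs _ _).trans (Finset.sum_le_sum fun c _ => ?_)
        rw [abs_mul]
        exact mul_le_mul (hf c) (abs_measureReal_inter_sub_le P hq (hΓm c) hB) (abs_nonneg _) hC
    _ = C * ((∑ c ∈ Finset.range (q + 1), P.real (Γ c)) * phi P i) := by
        rw [← Finset.mul_sum, Finset.sum_mul]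
    _ ≤ C * phi P i :=
        mul_le_mul_of_nonneg_left (mul_le_of_le_one_left (phi_nonneg P i) hone) hC

end Integrals

/-! ### Short returns -/

/-- The default value 0 of `sInf ∅` is harmless: a number strictly below the infimum forces the set
to be nonempty, so the minimum is attained and d < n comes for free. -/
lemma notMem_of_lt_selfReturn {n d : ℕ} {U : Set (ℕ → A)} (hd : 1 ≤ d)
    (h : d < selfReturn n U) : ¬(U ∩ shift^[d] ⁻¹' U).Nonempty := fun hne => by
  have hmem := Nat.sInf_mem (Nat.nonempty_of_pos_sInf ((Nat.zero_le d).trans_lt h))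
  exact Nat.notMem_of_lt_sInf h ⟨hd, (h.trans_le hmem.2.1).le, hne⟩

lemma notMem_of_lt_crossReturn {n m d : ℕ} {U V : Set (ℕ → A)} (h : d < crossReturn n m U V) :
    ¬((U ∩ shift^[d] ⁻¹' V).Nonempty ∨ (V ∩ shift^[d] ⁻¹' U).Nonempty) := fun hne => by
  have hmem := Nat.sInf_mem (Nat.nonempty_of_pos_sInf ((Nat.zero_le d).trans_lt h))
  exact Nat.notMem_of_lt_sInf h ⟨(h.trans_le hmem.1).le, hne⟩

lemma union_inter_preimage_eq_empty {n m d : ℕ} {U V : Set (ℕ → A)} (hd : 1 ≤ d)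
    (h : d < kappa n m U V) : (U ∪ V) ∩ shift^[d] ⁻¹' (U ∪ V) = ∅ := by
  rw [kappa, lt_min_iff, lt_min_iff] at h
  have h1 := notMem_of_lt_crossReturn h.1
  have h2 := notMem_of_lt_selfReturn hd h.2.1
  have h3 := notMem_of_lt_selfReturn hd h.2.2
  rw [Set.eq_empty_iff_forall_notMem]
  rintro ω ⟨hU | hV, hU' | hV'⟩
  · exact h2 ⟨ω, hU, hU'⟩
  · exact h1 (.inl ⟨ω, hU, hV'⟩)
  · exact h1 (.inr ⟨ω, hV, hU'⟩)
  · exact h3 ⟨ω, hV, hV'⟩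

/-! ### Error of one step -/

section Estimates

variable [MeasurableSpace A] {U V : Set (ℕ → A)}

lemma measurableSet_of_dependsOn_Icc [Countable A] [MeasurableSingletonClass A] {L : ℕ}
    (hU : DependsOn (fun ω => ω ∈ U) (Set.Icc 0 L)) : MeasurableSet U :=
  coordSigma_le _ _ (measurableSet_of_dependsOn (Set.finite_Icc _ _) hU)

/-- The probability of a return to `U ∪ V` after a time `d ≥ 1`. -/
lemma measureReal_inter_preimage_le [Countable A] [MeasurableSingletonClass A]
    (P : Measure (ℕ → A)) [IsProbabilityMeasure P] (hinv : MeasurePreserving (shift (A := A)) P P)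
    {L : ℕ} (hU : DependsOn (fun ω => ω ∈ U) (Set.Icc 0 L))
    (hV : DependsOn (fun ω => ω ∈ V) (Set.Icc 0 L)) {n m r d : ℕ} {i : ℤ}
    (hi : i + L ≤ kappa n m U V + r) (hd : 1 ≤ d) :
    P.real ((U ∪ V) ∩ shift^[d] ⁻¹' (U ∪ V)) ≤ (P.real U + P.real V) *
      (P.real (shift^[r] '' U) + P.real (shift^[r] '' V) + phi P i) := by
  have hphi := phi_nonneg P i
  rcases lt_or_ge d (kappa n m U V) with hlt | hge
  · rw [union_inter_preimage_eq_empty hd hlt, measureReal_empty]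
    positivity
  have hW : DependsOn (fun ω => ω ∈ U ∪ V) (Set.Icc 0 L) := fun x y hxy => by
    simpa using congrArg₂ Or (hU hxy) (hV hxy)
  set B := shift^[r] '' U ∪ shift^[r] '' V
  have hB : MeasurableSet B := (measurableSet_of_dependsOn_Icc (dependsOn_image_shift hU)).union
    (measurableSet_of_dependsOn_Icc (dependsOn_image_shift hV))
  -- A point of U ∪ V at time d is in B at time d + r. Forgetting the first r letters widens the gap
  -- after the coordinates 0, …, L, at the price of the larger set B.
  have hsub : (U ∪ V) ∩ shift^[d] ⁻¹' (U ∪ V) ⊆ (U ∪ V) ∩ shift^[d + r] ⁻¹' B := by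
    rintro ω ⟨hω, hω'⟩
    refine ⟨hω, ?_⟩
    rw [Set.mem_preimage, add_comm, Function.iterate_add_apply]
    rcases hω' with h | h
    · exact .inl ⟨_, h, rfl⟩
    · exact .inr ⟨_, h, rfl⟩
  have hmix := (abs_le.1 (abs_measureReal_inter_sub_le P (a := L) (d := d + r) (j := i)
    (by push_cast; omega) (measurableSet_of_dependsOn (Set.finite_Icc _ _) hW) hB)).2
  rw [(hinv.iterate (d + r)).measureReal_preimage hB.nullMeasurableSet] at hmix
  have hBle : P.real B ≤ P.real (shift^[r] '' U) + P.real (shift^[r] '' V) :=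
    measureReal_union_le _ _
  calc P.real ((U ∪ V) ∩ shift^[d] ⁻¹' (U ∪ V))
      ≤ P.real ((U ∪ V) ∩ shift^[d + r] ⁻¹' B) := measureReal_mono hsub
    _ ≤ P.real (U ∪ V) * (P.real B + phi P i) := by linarith
    _ ≤ _ := by
      refine mul_le_mul (measureReal_union_le _ _) (by linarith) ?_ (by positivity)
      positivity

/-- Replacing one indicator by its mean, given the past. The window of length `R` before the
time `j + 1` is discarded; `δ` bounds the probability of a return to `U ∪ V`. -/
lemma abs_integral_killed_mul_sub_le [Countable A] [MeasurableSingletonClass A]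
    (P : Measure (ℕ → A)) [IsProbabilityMeasure P] (hinv : MeasurePreserving (shift (A := A)) P P)
    {L : ℕ} (hU : DependsOn (fun ω => ω ∈ U) (Set.Icc 0 L))
    (hV : DependsOn (fun ω => ω ∈ V) (Set.Icc 0 L)) {f : ℕ → ℝ} {C : ℝ} (hf : ∀ c, |f c| ≤ C)
    {R : ℕ} {i : ℤ} (hi : i + L ≤ R + 1) {δ : ℝ}
    (hδ : ∀ d, 1 ≤ d → P.real ((U ∪ V) ∩ shift^[d] ⁻¹' (U ∪ V)) ≤ δ) {B : Set (ℕ → A)}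
    (hB : MeasurableSet B) (hBW : B ⊆ U ∪ V) (j : ℕ) :
    |∫ ω, killed U V f j ω * ((shift^[j + 1] ⁻¹' B).indicator 1 ω - P.real B) ∂P|
      ≤ C * phi P i + 2 * C * (R * δ + R * (P.real U + P.real V) * P.real B) := by
  have hC : 0 ≤ C := (abs_nonneg _).trans (hf 0)
  have hUm := measurableSet_of_dependsOn_Icc hU
  have hVm := measurableSet_of_dependsOn_Icc hV
  have hW := hUm.union hVm
  have hD := measurable_shift_iterate (j + 1) hB
  have hPD : P.real (shift^[j + 1] ⁻¹' B) = P.real B :=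
    (hinv.iterate (j + 1)).measureReal_preimage hB.nullMeasurableSet
  set D := shift^[j + 1] ⁻¹' B
  -- Truncated subtraction: q = 0 when the window reaches back to the start.
  set q := j - R with hq
  set E : Set (ℕ → A) := ⋃ k ∈ Finset.Ioc q j, shift^[k] ⁻¹' (U ∪ V) with hE
  have hEm : MeasurableSet E :=
    Finset.measurableSet_biUnion _ fun k _ => measurable_shift_iterate k hW
  have hcard : ((Finset.Ioc q j).card : ℝ) ≤ R := by
    rw [Nat.card_Ioc]; exact_mod_cast (by omega : j - q ≤ R)
  have hδ0 : 0 ≤ δ := measureReal_nonneg.trans (hδ 1 le_rfl)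
  have hPE : P.real E ≤ R * (P.real U + P.real V) := by
    refine (measureReal_biUnion_finset_le _ _).trans ?_
    refine (Finset.sum_le_card_nsmul _ _ (P.real U + P.real V) fun k _ => ?_).trans ?_
    · rw [(hinv.iterate k).measureReal_preimage hW.nullMeasurableSet]
      exact measureReal_union_le _ _
    · rw [nsmul_eq_mul]; gcongr
  have hPED : P.real (E ∩ D) ≤ R * δ := by
    rw [hE, Set.iUnion₂_inter]
    refine (measureReal_biUnion_finset_le _ _).trans ?_
    refine (Finset.sum_le_card_nsmul _ _ δ fun k hk => ?_).trans ?_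
    · rw [Finset.mem_Ioc] at hk
      have hsub : shift^[k] ⁻¹' (U ∪ V) ∩ D
          ⊆ shift^[k] ⁻¹' ((U ∪ V) ∩ shift^[j + 1 - k] ⁻¹' (U ∪ V)) := by
        rintro ω ⟨h1, h2⟩
        refine ⟨h1, ?_⟩
        rw [Set.mem_preimage, ← Function.iterate_add_apply, Nat.sub_add_cancel (by omega)]
        exact hBW h2
      refine (measureReal_mono hsub).trans ?_
      rw [(hinv.iterate k).measureReal_preimage
        (hW.inter (measurable_shift_iterate _ hW)).nullMeasurableSet]
      exact hδ _ (by omega)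
    · rw [nsmul_eq_mul]; gcongr
  have hint : ∀ k, Integrable (killed U V f k) P := fun k =>
    integrable_of_abs_le (measurable_killed hUm hVm f k) (abs_killed_le hf k)
  have hpast : |∫ ω, killed U V f q ω * (D.indicator 1 ω - P.real B) ∂P| ≤ C * phi P i := by
    -- For q = 0 there is no past: the killed function is constant and invariance makes the integral
    -- vanish. For q > 0, q = j - R exactly, and the gap is wide enough by `hi`.
    rcases Nat.eq_zero_or_pos q with h0 | hpos
    · have hconst : killed U V f q = fun _ => f 0 := by
        funext ω; simp [h0, killed, noHit, visitCount]
      have hi1 : Integrable (D.indicator (1 : (ℕ → A) → ℝ)) P :=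
        (integrable_const (1 : ℝ)).indicator hD
      rw [hconst, integral_const_mul, integral_sub hi1 (integrable_const _),
        integral_indicator_one hD, hPD]
      simpa using mul_nonneg hC (phi_nonneg P i)
    · rw [← hPD]
      exact abs_integral_killed_le P hU hV hf (by push_cast; omega) hB
  -- The two killed functions agree off E and differ by at most 2C on E, while |1_D - P(B)| ≤ 1_D +
  -- P(B). The sum is written as a difference with `-P.real B` to reuse the integral formula.
  have hwin : |∫ ω, (killed U V f j ω - killed U V f q ω) * (D.indicator 1 ω - P.real B) ∂P|
      ≤ 2 * C * (R * δ + R * (P.real U + P.real V) * P.real B) := by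
    have hiE : Integrable (E.indicator (1 : (ℕ → A) → ℝ)) P :=
      (integrable_const (1 : ℝ)).indicator hEm
    calc _ ≤ ∫ ω, 2 * C * (E.indicator 1 ω * (D.indicator 1 ω - -P.real B)) ∂P := by
          refine norm_integral_le_of_norm_le (f := fun ω =>
            (killed U V f j ω - killed U V f q ω) * (D.indicator 1 ω - P.real B))
            ((integrable_mul_indicator_sub hiE hD _).const_mul _) (ae_of_all _ fun ω => ?_)
          rw [Real.norm_eq_abs, abs_mul]
          by_cases hω : ω ∈ E
          · rw [Set.indicator_of_mem hω, Pi.one_apply, one_mul]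
            refine mul_le_mul ?_ ?_ (abs_nonneg _) (by positivity)
            · refine (abs_sub _ _).trans ?_
              linarith [abs_killed_le (U := U) (V := V) hf j ω,
                abs_killed_le (U := U) (V := V) hf q ω]
            · refine (abs_sub _ _).trans ?_
              rw [abs_of_nonneg (measureReal_nonneg (μ := P) (s := B)),
                abs_of_nonneg (Set.indicator_apply_nonneg fun _ => by simp), sub_neg_eq_add]
          · rw [killed_eq_of_forall_notMem f (Nat.sub_le j R) (ω := ω) fun k hk hk' =>
              hω (Set.mem_iUnion₂.2 ⟨k, hk, hk'⟩)]
            simp [hω, hq]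
      _ = 2 * C * (P.real (E ∩ D) + P.real E * P.real B) := by
          rw [integral_const_mul, integral_indicator_mul_indicator_sub hEm hD]; ring
      _ ≤ _ := by gcongr
  have hsplit : ∫ ω, killed U V f j ω * (D.indicator 1 ω - P.real B) ∂P
      = ∫ ω, killed U V f q ω * (D.indicator 1 ω - P.real B) ∂P
        + ∫ ω, (killed U V f j ω - killed U V f q ω) * (D.indicator 1 ω - P.real B) ∂P := by
    refine Eq.trans ?_ (integral_add (integrable_mul_indicator_sub (hint q) hD _)
      (integrable_mul_indicator_sub ((hint j).sub (hint q)) hD _))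
    congr 1; funext ω; ring
  rw [hsplit]
  exact (abs_add_le _ _).trans (add_le_add hpast hwin)

end Estimates

/-! ### Harmonic potential and comparison of laws -/

section Main

open ProbabilityTheory

/-- The probability that `c` plus a geometric variable with parameter `ρ` lies in `S`. -/
def geoShift (ρ : unitInterval) (S : Set ℕ) (c : ℕ) : ℝ :=
  (geometricMeasure ρ).real {k | k + c ∈ S}

lemma geoShift_nonneg (ρ : unitInterval) (S : Set ℕ) (c : ℕ) : 0 ≤ geoShift ρ S c :=
  measureReal_nonneg

lemma geoShift_le_one (ρ : unitInterval) (S : Set ℕ) (c : ℕ) : geoShift ρ S c ≤ 1 :=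
  measureReal_le_one

lemma geoShift_eq {ρ : unitInterval} (hρ : ρ ≠ 0) (S : Set ℕ) (c : ℕ) :
    geoShift ρ S c = (ρ : ℝ) * S.indicator 1 c + (1 - ρ) * geoShift ρ S (c + 1) := by
  rw [geoShift, geometricMeasure_real_succ hρ, geoShift]
  have h : ({k | k + c ∈ S} : Set ℕ).indicator (1 : ℕ → ℝ) 0 = S.indicator 1 c := by
    by_cases hc : c ∈ S
    · rw [Set.indicator_of_mem (by simpa using hc), Set.indicator_of_mem hc]; rfl
    · rw [Set.indicator_of_notMem (by simpa using hc), Set.indicator_of_notMem hc]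
  rw [h]
  simp only [Set.mem_ofPred_eq, add_right_comm, add_assoc]

variable [MeasurableSpace A]

/-- Harmonicity: the first step decomposition multiplied by P(V) + P(U). It is here that the value
of ρ is forced. -/
lemma geoShift_geoParam (P : Measure (ℕ → A)) {U V : Set (ℕ → A)} (hV : P.real V ≠ 0)
    (S : Set ℕ) (c : ℕ) :
    P.real V * (S.indicator 1 c - geoShift (geoParam P U V) S c)
      + P.real U * (geoShift (geoParam P U V) S (c + 1) - geoShift (geoParam P U V) S c) = 0 := by
  have hpos : 0 < P.real V + P.real U :=
    add_pos_of_pos_of_nonneg (lt_of_le_of_ne measureReal_nonneg hV.symm) measureReal_nonneg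
  have hρ : ((geoParam P U V : unitInterval) : ℝ) = P.real V / (P.real V + P.real U) := rfl
  have hne : geoParam P U V ≠ 0 := fun h => by
    rw [h] at hρ
    exact div_ne_zero hV hpos.ne' hρ.symm
  have h := geoShift_eq hne S c
  rw [hρ] at h
  rw [h]
  field_simp
  ring

/-- The chance of `c + Geo ∈ S`, increased by the chance of no success in `k` trials. -/
def potential (ρ : unitInterval) (S : Set ℕ) (b : ℝ) (k c : ℕ) : ℝ := geoShift ρ S c + (1 - b) ^ k

lemma abs_indicator_sub_potential_le {b : ℝ} (hb0 : 0 ≤ b) (hb1 : b ≤ 1) (ρ : unitInterval)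
    (S : Set ℕ) (k c : ℕ) : |S.indicator 1 c - potential ρ S b k c| ≤ 2 := by
  have h1 := geoShift_nonneg ρ S c
  have h2 := geoShift_le_one ρ S c
  have h3 : 0 ≤ (1 - b) ^ k := pow_nonneg (by linarith) k
  have h4 : (1 - b) ^ k ≤ 1 := pow_le_one₀ (by linarith) (by linarith)
  have h5 : 0 ≤ S.indicator (1 : ℕ → ℝ) c := Set.indicator_apply_nonneg fun _ => by simp
  have h6 : S.indicator (1 : ℕ → ℝ) c ≤ 1 :=
    Set.indicator_apply_le' (fun _ => le_rfl) fun _ => zero_le_one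
  rw [potential, abs_le]
  constructor <;> linarith

lemma abs_potential_sub_le (b : ℝ) (ρ : unitInterval) (S : Set ℕ) (k c : ℕ) :
    |potential ρ S b k (c + 1) - potential ρ S b k c| ≤ 2 := by
  have h1 := geoShift_nonneg ρ S c
  have h2 := geoShift_le_one ρ S c
  have h3 := geoShift_nonneg ρ S (c + 1)
  have h4 := geoShift_le_one ρ S (c + 1)
  rw [potential, potential, abs_le]
  constructor <;> linarith

/-- Replacing both indicators by their means turns g k into g (k + 1): the geometric part is
unchanged by harmonicity, and (1-b)^k - b(1-b)^k = (1-b)^(k+1). -/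
lemma killed_potential_succ (P : Measure (ℕ → A)) {U V : Set (ℕ → A)} (hUV : Disjoint U V)
    (hV : P.real V ≠ 0) (S : Set ℕ) (j k : ℕ) (ω : ℕ → A) :
    let g := potential (geoParam P U V) S (P.real V)
    killed U V (S.indicator 1) j ω * (shift^[j + 1] ⁻¹' V).indicator 1 ω
        + killed U V (g k) (j + 1) ω
      = killed U V (g (k + 1)) j ω
        + killed U V (fun c => S.indicator 1 c - g k c) j ω
            * ((shift^[j + 1] ⁻¹' V).indicator 1 ω - P.real V)
        + killed U V (fun c => g k (c + 1) - g k c) j ω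
            * ((shift^[j + 1] ⁻¹' U).indicator 1 ω - P.real U) := by
  intro g
  have hlin : killed U V (g (k + 1)) j ω = killed U V (g k) j ω
      + killed U V (fun c => S.indicator 1 c - g k c) j ω * P.real V
      + killed U V (fun c => g k (c + 1) - g k c) j ω * P.real U := by
    by_cases h : ω ∈ noHit V j
    · have := geoShift_geoParam P (U := U) hV S (visitCount U j ω)
      simp only [killed, h, Set.indicator_of_mem, g, potential, pow_succ]
      linear_combination -this
    · simp [killed, h]
  rw [killed_succ hUV, hlin]
  ring

/-- One-sided comparison of the law of the number of visits with the geometric law, in terms of a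
bound `δ` for the probability of a return to `U ∪ V`. -/
lemma measureReal_visits_le [Countable A] [MeasurableSingletonClass A]
    (P : Measure (ℕ → A)) [IsProbabilityMeasure P] (hinv : MeasurePreserving (shift (A := A)) P P)
    {U V : Set (ℕ → A)} (hUV : Disjoint U V) (hV0 : P.real V ≠ 0)
    {L : ℕ} (hU : DependsOn (fun ω => ω ∈ U) (Set.Icc 0 L))
    (hV : DependsOn (fun ω => ω ∈ V) (Set.Icc 0 L))
    {R : ℕ} {i : ℤ} (hi : i + L ≤ R + 1) {δ : ℝ}
    (hδ : ∀ d, 1 ≤ d → P.real ((U ∪ V) ∩ shift^[d] ⁻¹' (U ∪ V)) ≤ δ) (G : Set ℕ∞) (N : ℕ) :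
    P.real (visits U V ⁻¹' G) ≤ (geoLaw (geoParam P U V)).real G + (1 - P.real V) ^ N + P.real U
      + N * (4 * phi P i + 8 * R * δ + 4 * R * (P.real U + P.real V) ^ 2) := by
  have hUm := measurableSet_of_dependsOn_Icc hU
  have hVm := measurableSet_of_dependsOn_Icc hV
  set S : Set ℕ := (↑) ⁻¹' G
  set g := potential (geoParam P U V) S (P.real V) with hg
  set ε := 4 * phi P i + 8 * R * δ + 4 * R * (P.real U + P.real V) ^ 2 with hε
  have hgeo : (geoLaw (geoParam P U V)).real G = geoShift (geoParam P U V) S 0 := by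
    rw [geoLaw, map_measureReal_apply Measurable.of_discrete MeasurableSet.of_discrete]
    rfl
  have hb1 : P.real V ≤ 1 := measureReal_le_one
  have hpow : ∀ k, 0 ≤ (1 - P.real V) ^ k := fun k => pow_nonneg (by linarith) k
  have hint : ∀ (f : ℕ → ℝ) (j : ℕ) (C : ℝ), (∀ c, |f c| ≤ C) → Integrable (killed U V f j) P :=
    fun f j C hf => integrable_of_abs_le (measurable_killed hUm hVm f j) (abs_killed_le hf j)
  have hgle : ∀ k c, |g k c| ≤ 2 := fun k c => by
    have h1 := geoShift_nonneg (geoParam P U V) S c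
    have h2 := geoShift_le_one (geoParam P U V) S c
    have h4 : (1 - P.real V) ^ k ≤ 1 :=
      pow_le_one₀ (by linarith) (by linarith [measureReal_nonneg (μ := P) (s := V)])
    rw [hg, potential, abs_of_nonneg (add_nonneg h1 (hpow k))]
    linarith
  have hSle : ∀ c, |S.indicator (1 : ℕ → ℝ) c| ≤ 1 := fun c => by
    by_cases h : c ∈ S <;> simp [h]
  set D : ℕ → (ℕ → A) → ℝ := fun j ω =>
    killed U V (S.indicator 1) j ω * (shift^[j + 1] ⁻¹' V).indicator 1 ω
  have hDint : ∀ j, Integrable (D j) P := fun j =>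
    integrable_mul_indicator (hint _ j 1 hSle) (measurable_shift_iterate _ hVm)
  -- ε is the sum of two one-step errors with C = 2, one with B = V and one with B = U; the terms
  -- P(V) and P(U) add up to the second factor of the square.
  have hstep : ∀ j k, ∫ ω, D j ω ∂P + ∫ ω, killed U V (g k) (j + 1) ω ∂P
      ≤ ∫ ω, killed U V (g (k + 1)) j ω ∂P + ε := by
    intro j k
    have hα : ∀ c, |S.indicator 1 c - g k c| ≤ 2 := fun c =>
      abs_indicator_sub_potential_le measureReal_nonneg hb1 _ S k c
    have hβ : ∀ c, |g k (c + 1) - g k c| ≤ 2 := fun c => abs_potential_sub_le _ _ S k c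
    have h1 := le_of_abs_le (abs_integral_killed_mul_sub_le P hinv hU hV hα hi hδ hVm
      Set.subset_union_right j)
    have h2 := le_of_abs_le (abs_integral_killed_mul_sub_le P hinv hU hV hβ hi hδ hUm
      Set.subset_union_left j)
    have i1 := integrable_mul_indicator_sub (hint _ j 2 hα)
      (measurable_shift_iterate (j + 1) hVm) (P.real V)
    have i2 := integrable_mul_indicator_sub (hint _ j 2 hβ)
      (measurable_shift_iterate (j + 1) hUm) (P.real U)
    have i0 := hint _ j 2 (hgle (k + 1))
    have heq : ∫ ω, D j ω ∂P + ∫ ω, killed U V (g k) (j + 1) ω ∂P = _ :=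
      (integral_add (hDint j) (hint _ (j + 1) 2 (hgle k))).symm.trans <|
        (integral_congr_ae (ae_of_all _ (killed_potential_succ P hUV hV0 S j k))).trans <|
          (integral_add (i0.add i1) i2).trans (congrArg (· + _) (integral_add i0 i1))
    rw [heq, hε]
    linarith
  -- Elapsed plus remaining steps are constant, so k must vary in the induction. At time 0 the
  -- killed function is the constant g (k + j) 0.
  have htel : ∀ j k, ∑ l ∈ Finset.range j, ∫ ω, D l ω ∂P + ∫ ω, killed U V (g k) j ω ∂P
      ≤ g (k + j) 0 + j * ε := by
    intro j
    induction j with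
    | zero => intro k; simp [killed, noHit, visitCount]
    | succ j ih =>
      intro k
      rw [Finset.sum_range_succ]
      have h1 := hstep j k
      have h2 := ih (k + 1)
      rw [show k + 1 + j = k + (j + 1) by ring] at h2
      push_cast
      linarith
  have hle1 : ∀ ω, killed U V 1 N ω ≤ killed U V (g 0) N ω := fun ω => by
    refine Set.indicator_le_indicator ?_
    simpa [hg, potential] using geoShift_nonneg (geoParam P U V) S _
  have hUint : Integrable (U.indicator (1 : (ℕ → A) → ℝ)) P :=
    (integrable_const (1 : ℝ)).indicator hUm
  have hsumint : Integrable (fun ω => ∑ l ∈ Finset.range N, D l ω) P :=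
    integrable_finsetSum _ fun l _ => hDint l
  have hNint := hint _ N 2 (hgle 0)
  have hvis := measurable_visits hUm hVm (MeasurableSet.of_discrete (s := G))
  have hmain : P.real (visits U V ⁻¹' G)
      ≤ P.real U + ∑ l ∈ Finset.range N, ∫ ω, D l ω ∂P + ∫ ω, killed U V (g 0) N ω ∂P := by
    rw [← integral_indicator_one hvis, ← integral_indicator_one hUm,
      ← integral_finsetSum _ fun l _ => hDint l]
    refine le_of_le_of_eq ?_ ((integral_add (hUint.add hsumint) hNint).trans
      (congrArg (· + _) (integral_add hUint hsumint)))
    exact integral_mono ((integrable_const (1 : ℝ)).indicator hvis)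
      ((hUint.add hsumint).add hNint) fun ω =>
        (indicator_visits_le G N ω).trans (add_le_add le_rfl (hle1 ω))
  have hend := htel N 0
  rw [zero_add, hg, potential, ← hgeo] at hend
  linarith

/-- The lower bound on G is the upper bound on its complement. -/
lemma tvDist_le_of_measureReal_le {α : Type*} [MeasurableSpace α] {μ ν : Measure α}
    [IsProbabilityMeasure μ] [IsProbabilityMeasure ν] {b : ℝ} (hb : 0 ≤ b)
    (h : ∀ G, MeasurableSet G → μ.real G ≤ ν.real G + b) : tvDist μ ν ≤ b := by
  refine Real.sSup_le ?_ hb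
  rintro _ ⟨G, hG, rfl⟩
  have h1 := h G hG
  have h2 := h Gᶜ hG.compl
  rw [probReal_compl_eq_one_sub hG, probReal_compl_eq_one_sub hG] at h2
  rw [abs_le]
  constructor <;> linarith

instance (ρ : unitInterval) : IsProbabilityMeasure (geoLaw ρ) :=
  Measure.isProbabilityMeasure_map Measurable.of_discrete.aemeasurable

end Main

end PhiMixingShift

end

theorem theorem2p1 {A : Type*} [Countable A] [MeasurableSpace A] [MeasurableSingletonClass A]
    (P : Measure (ℕ → A)) [IsProbabilityMeasure P]
    (hinv : MeasurePreserving (PhiMixingShift.shift (A := A)) P P)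
    (hmix : PhiMixingShift.IsPhiMixing P)
    (n m M R : ℕ) (hn : 1 ≤ n) (hm : 1 ≤ m) (hM : 1 ≤ M) (hR : 1 ≤ R)
    (U V : Set (ℕ → A))
    (hU : MeasurableSet[PhiMixingShift.blockSigma A 0 (n - 1)] U) (hU0 : U.Nonempty)
    (hV : MeasurableSet[PhiMixingShift.blockSigma A 0 (m - 1)] V) (hV0 : V.Nonempty)
    (hUV : Disjoint U V)
    (r : ℕ) (hr : r < min n m) :
    PhiMixingShift.tvDist (P.map (PhiMixingShift.visits U V))
        (PhiMixingShift.geoLaw (PhiMixingShift.geoParam P U V)) ≤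
      2 * ((1 - P.real V) ^ (M + 1) + P.real U
        + 6 * (M : ℝ) * (R : ℝ) * (P.real U + P.real V) ^ 2
        + 6 * (M : ℝ) * PhiMixingShift.phi P ((R : ℤ) - ((max n m : ℕ) : ℤ))
        + 8 * (M : ℝ) * (R : ℝ) * (P.real U + P.real V) *
          (P.real (PhiMixingShift.shift^[r] '' U) + P.real (PhiMixingShift.shift^[r] '' V)
            + PhiMixingShift.phi P
                ((PhiMixingShift.kappa n m U V : ℤ) + (r : ℤ) - ((max n m : ℕ) : ℤ)))) := by
  open PhiMixingShift in
  have hUm : MeasurableSet U := coordSigma_le _ _ hU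
  have hVm : MeasurableSet V := coordSigma_le _ _ hV
  have hvis := measurable_visits hUm hVm
  have : IsProbabilityMeasure (P.map (visits U V)) :=
    Measure.isProbabilityMeasure_map hvis.aemeasurable
  have hφ := phi_nonneg P ((R : ℤ) - ((max n m : ℕ) : ℤ))
  have hφ' := phi_nonneg P ((kappa n m U V : ℤ) + (r : ℤ) - ((max n m : ℕ) : ℤ))
  have hpow : 0 ≤ (1 - P.real V) ^ (M + 1) :=
    pow_nonneg (sub_nonneg.2 measureReal_le_one) _
  set p := P.real U + P.real V
  set φ := phi P ((R : ℤ) - ((max n m : ℕ) : ℤ))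
  set η := P.real (shift^[r] '' U) + P.real (shift^[r] '' V)
    + phi P ((kappa n m U V : ℤ) + (r : ℤ) - ((max n m : ℕ) : ℤ)) with hη
  have hp0 : 0 ≤ p := by positivity
  have hη0 : 0 ≤ η := by positivity
  have hMR : 0 ≤ (M : ℝ) * R * p ^ 2 := by positivity
  have hMη : 0 ≤ (M : ℝ) * R * p * η := by positivity
  have hMφ : 0 ≤ (M : ℝ) * φ := by positivity
  have hPU : 0 ≤ P.real U := measureReal_nonneg
  refine tvDist_le_of_measureReal_le (by linarith) fun G hG => ?_
  rw [map_measureReal_apply hvis hG]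
  -- For P(V) = 0 the power (1 - P(V))^(M+1) equals 1, so the bound is trivial whatever the
  -- geometric law is.
  rcases eq_or_ne (P.real V) 0 with h0 | h0
  · have h1 : P.real (visits U V ⁻¹' G) ≤ 1 := measureReal_le_one
    have h2 : 0 ≤ (geoLaw (geoParam P U V)).real G := measureReal_nonneg
    simp only [h0, sub_zero, one_pow]
    linarith
  have hUd : DependsOn (fun ω => ω ∈ U) (Set.Icc 0 (max n m - 1)) :=
    (dependsOn_of_measurableSet hU).mono (Set.Icc_subset_Icc_right (by omega))
  have hVd : DependsOn (fun ω => ω ∈ V) (Set.Icc 0 (max n m - 1)) :=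
    (dependsOn_of_measurableSet hV).mono (Set.Icc_subset_Icc_right (by omega))
  -- With L = max n m - 1, this choice gives i + L = R - 1, within the allowed R + 1. The horizon is
  -- N = M + 1.
  have hmain := measureReal_visits_le P hinv hUV h0 hUd hVd (R := R)
    (i := (R : ℤ) - ((max n m : ℕ) : ℤ)) (by omega)
    (fun d hd => measureReal_inter_preimage_le P hinv hUd hVd (n := n) (m := m) (r := r)
      (i := (kappa n m U V : ℤ) + (r : ℤ) - ((max n m : ℕ) : ℤ)) (by omega) hd) G (M + 1)
  -- As M ≥ 1, the M + 1 steps cost at most 2M errors, that is 8Mφ + 16MRpη + 8MRp², below the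
  -- stated 12Mφ + 16MRpη + 12MRp².
  have hM2 : ((M + 1 : ℕ) : ℝ) ≤ 2 * M := by exact_mod_cast (by omega : M + 1 ≤ 2 * M)
  have hN : ((M + 1 : ℕ) : ℝ) * (4 * φ + 8 * R * (p * η) + 4 * R * p ^ 2)
      ≤ 2 * M * (4 * φ + 8 * R * (p * η) + 4 * R * p ^ 2) :=
    mul_le_mul_of_nonneg_right hM2 (by positivity)
  linarith
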